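/- Model. Registers hold one bit each. Alice starts with $n$ input registers containing $x\in\{0,1\}^n$ and some number of ancilla bits equal to $0$; Bob starts with $n$ input registers containing $y\in\{0,1\}^n$, some number of ancilla bits equal to $0$, and a one-bit answer register containing $z\in\{0,1\}$. In each turn of a protocol one player applies a reversible transformation (a permutation of the set of joint values) to the bits currently in that player's possession and then sends some subset of these bits to the other player; the protocol, including which registers are sent, is fixed independently of $x,y,z$. The cost of a protocol is the total number of bits sent. A protocol computes $f:\{0,1\}^n\times\{0,1\}^n\to\{0,1\}$ (exactly and) cleanly if, for all $x,y,z$, it ends with Alice holding her input registers containing $x$, Bob holding his input registers containing $y$ and the answer register containing $z\oplus f(x,y)$, and all ancilla bits equal to $0$. The clean classical communication complexity $C_{\mathrm{clean}}(f)$ is the minimum cost of a protocol, with any numbers of ancilla bits, that computes $f$ cleanly. Theorem. Let $\mathrm{IP}_n(x,y)=\sum_{i=1}^n x_iy_i \bmod 2$. For every $n\ge 1$, $$n+1\le C_{\mathrm{clean}}(\mathrm{IP}_n),$$ and for every $n\ge 2$, $$C_{\mathrm{clean}}(\mathrm{IP}_n)\le n+4\sqrt n+\frac{1}{\sqrt n-1}+2.$$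 Moreover, no ancilla bits are required for the upper bound: for every $n\ge2$ there is a protocol without ancilla bits that computes $\mathrm{IP}_n$ cleanly at a cost of at most $n+4\sqrt n+\frac{1}{\sqrt n-1}+2$. -/

import Mathlib

namespace CleanComm

/-- The two players. -/
inductive Player where
  | alice
  | bob
  deriving DecidableEq

/-- The player a message is sent to. -/
def Player.other : Player → Player
  | .alice => .bob
  | .bob => .alice

/-- The one-bit registers of a protocol on two `n`-bit inputs in which Alice starts with `a`
ancilla bits and Bob starts with `b` ancilla bits. -/
inductive Reg (n a b : ℕ) where
  | aliceIn (i : Fin n)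
  | aliceAnc (i : Fin a)
  | bobIn (i : Fin n)
  | bobAnc (i : Fin b)
  | ans
  deriving DecidableEq

/-- A joint state: the content of every register, a bit being an element of `ZMod 2`. -/
abbrev State (n a b : ℕ) : Type := Reg n a b → ZMod 2

/-- The player who holds a register at the start; the answer register is Bob's. -/
def Reg.home {n a b : ℕ} : Reg n a b → Player
  | .aliceIn _ => .alice
  | .aliceAnc _ => .alice
  | .bobIn _ => .bob
  | .bobAnc _ => .bob
  | .ans => .bob

/-- The state with inputs `x` and `y`, all ancilla bits `0` and the answer register equal to `z`. -/
def stdState {n : ℕ} (a b : ℕ) (x y : Fin n → ZMod 2) (z : ZMod 2) : State n a b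
  | .aliceIn i => x i
  | .aliceAnc _ => 0
  | .bobIn i => y i
  | .bobAnc _ => 0
  | .ans => z

/-- A transformation of joint states acts only on the registers in `S`: it leaves all other
registers unchanged, and the new content of `S` depends only on the old content of `S`. -/
def ActsOn {n a b : ℕ} (S : Set (Reg n a b)) (g : State n a b → State n a b) : Prop :=
  (∀ s, ∀ r ∉ S, g s r = s r) ∧
    ∀ s s', (∀ r ∈ S, s r = s' r) → ∀ r ∈ S, g s r = g s' r

/-- One turn: `player` applies the reversible transformation `op` and then sends the registers in
`sent` to the other player. -/
structure Turn (n a b : ℕ) where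
  player : Player
  op : Equiv.Perm (State n a b)
  sent : Finset (Reg n a b)

/-- The holder of each register after a turn, if it was given by `h` before the turn. -/
def Turn.newHolder {n a b : ℕ} (t : Turn n a b) (h : Reg n a b → Player) : Reg n a b → Player :=
  fun r => if r ∈ t.sent then t.player.other else h r

/-- A turn is legal, when register `r` is held by `h r`, if the player acts only on registers in
the player's possession and sends only such registers. -/
def Turn.Legal {n a b : ℕ} (t : Turn n a b) (h : Reg n a b → Player) : Prop :=
  ActsOn {r | h r = t.player} t.op ∧ ∀ r ∈ t.sent, h r = t.player

/-- A protocol is a finite sequence of turns. A turn may send nothing, so requiring that the two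
players strictly alternate would not restrict anything. -/
abbrev Protocol (n a b : ℕ) : Type := List (Turn n a b)

namespace Protocol

variable {n a b : ℕ}

/-- All turns are legal, when the registers are initially held according to `h`. -/
def LegalFrom : Protocol n a b → (Reg n a b → Player) → Prop
  | [], _ => True
  | t :: P, h => t.Legal h ∧ LegalFrom P (t.newHolder h)

/-- The holders of the registers at the end. -/
def holderFrom : Protocol n a b → (Reg n a b → Player) → Reg n a b → Player
  | [], h => h
  | t :: P, h => holderFrom P (t.newHolder h)

/-- The joint state at the end, when the protocol starts in the state `s`. -/
def run : Protocol n a b → State n a b → State n a b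
  | [], s => s
  | t :: P, s => run P (t.op s)

/-- The communication cost: the total number of bits sent, in both directions. -/
def cost : Protocol n a b → ℕ
  | [] => 0
  | t :: P => t.sent.card + cost P

/-- The protocol computes `f` cleanly (and exactly): for all inputs `x`, `y` and every initial
value `z` of the answer register, the input registers end with their initial content, all ancilla
bits end as `0`, and the answer register ends as `z + f x y` modulo 2; and at the end the input
registers are with their owners and the answer register is with Bob. (An ancilla bit, which is
back in state `0`, may have changed hands.) -/
def ComputesCleanly (P : Protocol n a b) (f : (Fin n → ZMod 2) → (Fin n → ZMod 2) → ZMod 2) :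
    Prop :=
  P.LegalFrom Reg.home ∧
  (∀ x y z, P.run (stdState a b x y z) = stdState a b x y (z + f x y)) ∧
  (∀ i, P.holderFrom Reg.home (.aliceIn i) = .alice) ∧
  (∀ i, P.holderFrom Reg.home (.bobIn i) = .bob) ∧
  P.holderFrom Reg.home .ans = .bob

end Protocol

/-- The clean classical communication complexity of `f`: the minimum cost of a protocol that
computes `f` cleanly, with any numbers of ancilla bits. -/
noncomputable def cleanComplexity {n : ℕ}
    (f : (Fin n → ZMod 2) → (Fin n → ZMod 2) → ZMod 2) : ℕ :=
  sInf {c : ℕ | ∃ (a b : ℕ) (P : Protocol n a b), P.ComputesCleanly f ∧ P.cost = c}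

/-- The inner product modulo 2 of two `n`-bit strings. -/
def innerProduct (n : ℕ) (x y : Fin n → ZMod 2) : ZMod 2 := ∑ i, x i * y i

end CleanComm

/-! ### Transcripts, and their consequences for Alice's and Bob's registers. -/

namespace CleanComm

/-! Lower bound. Fix `z = 0` and suppose that at most `n` bits are sent. By cut and paste
(`transcript_paste`), the inputs with a given transcript form a rectangle, and since Bob ends with
the answer, on this rectangle the function depends on `y` alone. The sign matrix of the inner
product is thus a product `A * B` through the set of transcripts. It is invertible of size `2 ^ n`,
so there are exactly `2 ^ n` transcripts and both factors are invertible. This forces every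
rectangle to contain all `y`, so the transcript depends on `x` only, and injectively
(`injective_of_rectangles`). For `y = 0` all transcripts then occur, hence Bob never sends a bit
(`sent_eq_empty_of_surjective`). By reversibility his final registers then determine the transcript
(`transcript_eq_of_run_eq`). But a clean protocol leaves them the same for `x = 0` and `x = 1` when
`y = 0`, a contradiction.

Upper bound. Cut the inputs into an even number `m` of blocks of length `k` (the last ones possibly
padded with zeros); only Alice's block `0` and the answer register travel. Block `0` serves as a
dirty carrier: Alice adds an odd block `x_j` to it and Bob adds its product with `y_j` to the
answer, or Bob adds an even block `y_j` and Alice multiplies with `x_j`. The carrier's own content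
contributes the errors `x_0 · y_j` and `x_0 · x_j`. Each is linear in `x_0` with a coefficient known
to one player, so one last round removes them all and also adds `x_0 · y_0`
(`reaches_innerProduct`). The cost is `k * m + m + 2 * k`, and `m ≈ √n` makes it about `n + 4√n`. -/

/-- Graft the `S`-part of `s'` onto `s`: the result and `s` have the same image, so injectivity of
the permutation identifies them. This is where reversibility enters the lower bound. -/
theorem ActsOn.agree_of_agree {n a b : ℕ} {S : Set (Reg n a b)}
    {g : Equiv.Perm (State n a b)} (hg : ActsOn S g) {s s' : State n a b}
    (h : ∀ r ∈ S, g s r = g s' r) : ∀ r ∈ S, s r = s' r := by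
  classical
  have key : g (fun r => if r ∈ S then s' r else s r) = g s := by
    funext r
    by_cases hr : r ∈ S
    · rw [h r hr]
      exact hg.2 _ _ (fun r hr => by simp [hr]) r hr
    · rw [hg.1 _ r hr, hg.1 _ r hr]
      simp [hr]
  intro r hr
  have := congrFun (g.injective key) r
  simpa [hr] using this.symm

namespace Protocol

variable {n a b : ℕ}

/-- The bits sent during a run of the protocol, in a fixed order. -/
noncomputable def transcript : Protocol n a b → State n a b → List (ZMod 2)
  | [], _ => []
  | t :: P, s => t.sent.toList.map (t.op s) ++ transcript P (t.op s)

theorem length_transcript (P : Protocol n a b) (s : State n a b) :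
    (P.transcript s).length = P.cost := by
  induction P generalizing s with
  | nil => rfl
  | cons t P ih => simp [transcript, cost, ih]

theorem transcript_cons_eq_iff {t : Turn n a b} {P : Protocol n a b} {s s' : State n a b} :
    transcript (t :: P) s = transcript (t :: P) s' ↔
      (∀ r ∈ t.sent, t.op s r = t.op s' r) ∧
        transcript P (t.op s) = transcript P (t.op s') := by
  rw [transcript, transcript]
  refine ⟨fun h => ?_, fun ⟨h₁, h₂⟩ => ?_⟩
  · obtain ⟨h₁, h₂⟩ := List.append_inj h (by simp)
    exact ⟨fun r hr => List.map_inj_left.mp h₁ r (by simpa using hr), h₂⟩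
  · rw [h₂, List.map_inj_left.mpr fun r hr => h₁ r (by simpa using hr)]

/-- Cut and paste: if two runs have the same transcript, then so does the run in which Alice
starts as in the first one and Bob as in the second one, and it ends accordingly. -/
theorem transcript_paste (P : Protocol n a b) {h : Reg n a b → Player} (hP : P.LegalFrom h)
    {s₁ s₂ s₃ : State n a b} (hA : ∀ r, h r = .alice → s₃ r = s₁ r)
    (hB : ∀ r, h r = .bob → s₃ r = s₂ r) (ht : P.transcript s₁ = P.transcript s₂) :
    P.transcript s₃ = P.transcript s₁ ∧
      (∀ r, P.holderFrom h r = .alice → P.run s₃ r = P.run s₁ r) ∧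
      ∀ r, P.holderFrom h r = .bob → P.run s₃ r = P.run s₂ r := by
  induction P generalizing h s₁ s₂ s₃ with
  | nil => exact ⟨rfl, hA, hB⟩
  | cons t P ih =>
    obtain ⟨⟨hact, hsent⟩, hP⟩ := hP
    rw [transcript_cons_eq_iff] at ht
    obtain ⟨hmsg, ht⟩ := ht
    have hA' : ∀ r, h r = .alice → t.op s₃ r = t.op s₁ r := by
      intro r hr
      by_cases hp : t.player = .alice
      · exact hact.2 _ _ (fun r hr => hA r (by simpa [hp] using hr)) r (by simpa [hp] using hr)
      · rw [hact.1 _ r (by simpa [hr] using Ne.symm hp),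
          hact.1 _ r (by simpa [hr] using Ne.symm hp), hA r hr]
    have hB' : ∀ r, h r = .bob → t.op s₃ r = t.op s₂ r := by
      intro r hr
      by_cases hp : t.player = .bob
      · exact hact.2 _ _ (fun r hr => hB r (by simpa [hp] using hr)) r (by simpa [hp] using hr)
      · rw [hact.1 _ r (by simpa [hr] using Ne.symm hp),
          hact.1 _ r (by simpa [hr] using Ne.symm hp), hB r hr]
    have hS : ∀ r ∈ t.sent, t.op s₃ r = t.op s₁ r := by
      intro r hr
      cases hh : h r with
      | alice => exact hA' r hh
      | bob => rw [hB' r hh, hmsg r hr]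
    have := ih (h := t.newHolder h) (s₁ := t.op s₁) (s₂ := t.op s₂) (s₃ := t.op s₃) hP
      (fun r hr => by
        by_cases hm : r ∈ t.sent
        · exact hS r hm
        · exact hA' r (by simpa [Turn.newHolder, hm] using hr))
      (fun r hr => by
        by_cases hm : r ∈ t.sent
        · rw [hS r hm, hmsg r hm]
        · exact hB' r (by simpa [Turn.newHolder, hm] using hr)) ht
    refine ⟨?_, this.2⟩
    rw [transcript_cons_eq_iff]
    exact ⟨hS, this.1⟩

/-- If every transcript occurs on some set of states that agree on the registers of Bob, then Bob
never sends anything. -/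
theorem sent_eq_empty_of_surjective (P : Protocol n a b) {h : Reg n a b → Player}
    (hP : P.LegalFrom h) (S : Set (State n a b))
    (hS : ∀ s ∈ S, ∀ s' ∈ S, ∀ r, h r = .bob → s r = s' r)
    (hsurj : ∀ l : List (ZMod 2), l.length = P.cost → ∃ s ∈ S, P.transcript s = l) :
    ∀ t ∈ P, t.player = .bob → t.sent = ∅ := by
  induction P generalizing h S with
  | nil => simp
  | cons t P ih =>
    obtain ⟨⟨hact, hsent⟩, hP⟩ := hP
    have hop : ∀ s ∈ S, ∀ s' ∈ S, ∀ r, h r = .bob → t.op s r = t.op s' r := by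
      intro s hs s' hs' r hr
      by_cases hp : t.player = .bob
      · exact hact.2 _ _ (fun r hr => hS s hs s' hs' r (by simpa [hp] using hr)) r
          (by simpa [hp] using hr)
      · rw [hact.1 _ r (by simpa [hr] using Ne.symm hp),
          hact.1 _ r (by simpa [hr] using Ne.symm hp), hS s hs s' hs' r hr]
    have hbob : t.player = .bob → t.sent = ∅ := by
      intro hp
      by_contra hne
      obtain ⟨r, hr⟩ := Finset.nonempty_iff_ne_empty.mpr hne
      -- Constant transcripts suffice to make one sent bit take both values, whereas Bob's registers
      -- are the same throughout `S`.
      have hex : ∀ c : ZMod 2, ∃ s ∈ S, t.op s r = c := by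
        intro c
        obtain ⟨s, hs, he⟩ := hsurj (List.replicate (cost (t :: P)) c) (by simp)
        refine ⟨s, hs, ?_⟩
        have hmem : t.op s r ∈ transcript (t :: P) s := by
          rw [transcript]
          exact List.mem_append_left _ (List.mem_map_of_mem (by simpa using hr))
        rw [he] at hmem
        exact List.eq_of_mem_replicate hmem
      obtain ⟨s, hs, h0⟩ := hex 0
      obtain ⟨s', hs', h1⟩ := hex 1
      have := hop s hs s' hs' r (by rw [hsent r hr, hp])
      rw [h0, h1] at this
      exact zero_ne_one this
    -- Keep only the states whose message in this turn is all zeros: Bob's registers still agree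
    -- after he receives it, and every continuation still occurs.
    have hrest := ih (h := t.newHolder h) hP
      {s' | ∃ s ∈ S, t.op s = s' ∧ ∀ r ∈ t.sent, s' r = 0}
      (by
        rintro _ ⟨s, hs, rfl, h0⟩ _ ⟨s', hs', rfl, h0'⟩ r hr
        by_cases hm : r ∈ t.sent
        · rw [h0 r hm, h0' r hm]
        · exact hop s hs s' hs' r (by simpa [Turn.newHolder, hm] using hr))
      (by
        intro l hl
        obtain ⟨s, hs, he⟩ := hsurj (List.replicate t.sent.card 0 ++ l) (by simp [cost, hl])
        rw [transcript] at he
        obtain ⟨h1, h2⟩ := List.append_inj he (by simp)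
        refine ⟨t.op s, ⟨s, hs, rfl, fun r hr => ?_⟩, h2⟩
        have hmem : t.op s r ∈ t.sent.toList.map (t.op s) :=
          List.mem_map_of_mem (by simpa using hr)
        rw [h1] at hmem
        exact List.eq_of_mem_replicate hmem)
    intro t' ht'
    rcases List.mem_cons.mp ht' with rfl | ht'
    · exact hbob
    · exact hrest t' ht'

/-- If Bob never sends anything, the registers he holds at the end determine the transcript. -/
theorem transcript_eq_of_run_eq (P : Protocol n a b) {h : Reg n a b → Player}
    (hP : P.LegalFrom h) (hbob : ∀ t ∈ P, t.player = .bob → t.sent = ∅) {s s' : State n a b}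
    (hrun : ∀ r, P.holderFrom h r = .bob → P.run s r = P.run s' r) :
    P.transcript s = P.transcript s' ∧ ∀ r, h r = .bob → s r = s' r := by
  induction P generalizing h s s' with
  | nil => exact ⟨rfl, hrun⟩
  | cons t P ih =>
    obtain ⟨⟨hact, hsent⟩, hP⟩ := hP
    obtain ⟨htr, hag⟩ := ih (h := t.newHolder h) hP (fun t ht => hbob t (by simp [ht])) hrun
    cases hp : t.player with
    | alice =>
      refine ⟨transcript_cons_eq_iff.mpr ⟨fun r hr => hag r ?_, htr⟩, fun r hr => ?_⟩
      · simp [Turn.newHolder, hr, hp, Player.other]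
      · have hne : r ∉ {r | h r = t.player} := by simp [hr, hp]
        rw [← hact.1 s r hne, ← hact.1 s' r hne]
        refine hag r ?_
        simp [Turn.newHolder, hr, hp, Player.other]
    | bob =>
      have he := hbob t (by simp) hp
      have hn : t.newHolder h = h := by funext r; simp [Turn.newHolder, he]
      rw [hn] at hag
      refine ⟨transcript_cons_eq_iff.mpr ⟨by simp [he], htr⟩, fun r hr => ?_⟩
      exact hact.agree_of_agree (fun r hr => hag r (by simpa [hp] using hr)) r (by simpa [hp] using hr)

end Protocol

/-! ### Rectangle partitions of an invertible sign matrix. -/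

open Matrix in
/-- A partition of an invertible sign matrix into at most as many rectangles as it has rows, each
with constant columns, separates the rows at every column. -/
theorem injective_of_rectangles {X V : Type*} [Fintype X] [DecidableEq X] [Fintype V]
    [DecidableEq V] (M : Matrix X X ℚ) (hM : IsUnit M) (hsq : ∀ x y, M x y * M x y = 1)
    (T : X → X → V) (hcard : Fintype.card V ≤ Fintype.card X)
    (hrect : ∀ x y x' y', T x y = T x' y' → T x y' = T x y)
    (hcol : ∀ x x' y, T x y = T x' y → M x y = M x' y) (y₀ : X) :
    Function.Injective fun x => T x y₀ := by
  classical
  -- `A` marks the rows of each rectangle, and `B` holds its common column values, with `0` off its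
  -- columns. Squaring the entries of `B` gives `C`, which marks the columns.
  let A : Matrix X V ℚ := fun x v => if ∃ y, T x y = v then 1 else 0
  let B : Matrix V X ℚ := fun v y => if h : ∃ x, T x y = v then M h.choose y else 0
  let C : Matrix V X ℚ := fun v y => B v y * B v y
  have hA : ∀ x y v, A x v * B v y = if v = T x y then M x y else 0 := by
    intro x y v
    simp only [A, B]
    by_cases h3 : v = T x y
    · subst h3
      have h2 : ∃ x', T x' y = T x y := ⟨x, rfl⟩
      rw [if_pos ⟨y, rfl⟩, dif_pos h2, if_pos rfl, one_mul]
      exact hcol _ _ _ h2.choose_spec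
    · rw [if_neg h3]
      by_cases h1 : ∃ y', T x y' = v
      · rw [dif_neg, mul_zero]
        rintro ⟨x', hx'⟩
        obtain ⟨y', hy'⟩ := h1
        have := hrect x y' x' y (by rw [hy', hx'])
        exact h3 (by rw [this, hy'])
      · rw [if_neg h1, zero_mul]
  have hAB : A * B = M := by
    ext x y
    simp [Matrix.mul_apply, hA]
  -- Each cell lies in exactly one rectangle.
  have hAC : ∀ y, A *ᵥ (fun v => C v y) = fun _ => 1 := by
    intro y
    funext x
    have : ∀ v, A x v * C v y = if v = T x y then 1 else 0 := by
      intro v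
      simp only [C, ← mul_assoc]
      rw [hA]
      split_ifs with h
      · have h2 := hA x y v
        rw [if_pos h] at h2
        have h1 : A x v = 1 := by simp only [A]; rw [if_pos ⟨y, h.symm⟩]
        rw [h1, one_mul] at h2
        rw [h2, hsq]
      · simp
    simp [Matrix.mulVec, dotProduct, this]
  have hMbij : Function.Bijective M.mulVec := by
    refine ⟨Matrix.mulVec_injective_iff_isUnit.mpr hM, Matrix.mulVec_surjective_iff_isUnit.mpr hM⟩
  have hAsurj : Function.Surjective A.mulVecLin := by
    intro w
    obtain ⟨u, hu⟩ := hMbij.2 w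
    exact ⟨B *ᵥ u, by simpa [Matrix.mulVec_mulVec, hAB] using hu⟩
  have hcard' : Fintype.card V = Fintype.card X := by
    refine le_antisymm hcard ?_
    have := LinearMap.finrank_le_finrank_of_surjective (f := A.mulVecLin) hAsurj
    simpa using this
  have hAinj : Function.Injective A.mulVecLin :=
    (LinearMap.injective_iff_surjective_of_finrank_eq_finrank (by simpa using hcard')).mpr hAsurj
  have hBinj : Function.Injective B.mulVecLin := by
    intro u u' h
    apply hMbij.1
    rw [← hAB, ← Matrix.mulVec_mulVec, ← Matrix.mulVec_mulVec]
    exact congrArg _ h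
  have hBsurj : Function.Surjective B.mulVecLin :=
    (LinearMap.injective_iff_surjective_of_finrank_eq_finrank (by simpa using hcard'.symm)).mp hBinj
  -- All columns of `C` solve the same system with the injective matrix `A`, so they coincide: a
  -- rectangle contains every column or none. The second case would give `B` a zero row, against its
  -- surjectivity.
  have hconst : ∀ v y y', C v y = C v y' := by
    intro v y y'
    have : (fun v => C v y) = fun v => C v y' := hAinj (by
      simp only [Matrix.mulVecLin_apply, hAC])
    exact congrFun this v
  have hBne : ∀ v y, B v y ≠ 0 := by
    intro v y h
    have hz : ∀ y', B v y' = 0 := by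
      intro y'
      have := hconst v y' y
      simpa [C, h] using this
    obtain ⟨u, hu⟩ := hBsurj (Pi.single v 1)
    have := congrFun hu v
    simp [Matrix.mulVec, dotProduct, hz] at this
  have hindep : ∀ x y, T x y = T x y₀ := by
    intro x y
    have h : ∃ x', T x' y = T x y₀ := by
      by_contra h
      exact hBne (T x y₀) y (by simp only [B]; rw [dif_neg h])
    obtain ⟨x', hx'⟩ := h
    exact hrect x y₀ x' y hx'.symm
  intro x x' hxx'
  have hrow : ∀ y, M x y = M x' y := by
    intro y
    refine hcol x x' y ?_
    rw [hindep, hindep x']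
    exact hxx'
  have hu := Matrix.vecMul_injective_iff_isUnit.mpr hM
  have : Pi.single x (1 : ℚ) = Pi.single x' 1 := hu (by
    funext y
    simp [hrow])
  by_contra hne
  have := congrFun this x
  simp [hne] at this

/-! ### The sign matrix of the inner product. -/

/-- The sign `(-1)^c` of a bit. -/
def bitSign (c : ZMod 2) : ℚ := if c = 0 then 1 else -1

theorem bitSign_add (c d : ZMod 2) : bitSign (c + d) = bitSign c * bitSign d := by
  fin_cases c <;> fin_cases d <;> simp [bitSign] <;> rfl

theorem bitSign_mul_self (c : ZMod 2) : bitSign c * bitSign c = 1 := by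
  rw [← bitSign_add, CharTwo.add_self_eq_zero]; rfl

/-- Flipping a bit of `y` where `x` is nonzero reverses the sign, so the terms cancel in pairs. -/
theorem sum_bitSign_innerProduct {n : ℕ} {x : Fin n → ZMod 2} (hx : x ≠ 0) :
    ∑ y, bitSign (innerProduct n x y) = 0 := by
  obtain ⟨i, hi⟩ := Function.ne_iff.mp hx
  have h1 : x i = 1 := by
    have : ∀ c : ZMod 2, c ≠ 0 → c = 1 := by decide
    exact this _ hi
  have h := Equiv.sum_comp (Equiv.addRight (Pi.single i (1 : ZMod 2)))
    fun y => bitSign (innerProduct n x y)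
  have h2 : ∀ y, bitSign (innerProduct n x (y + Pi.single i 1)) =
      - bitSign (innerProduct n x y) := by
    intro y
    have : innerProduct n x (y + Pi.single i 1) = innerProduct n x y + 1 := by
      simp [innerProduct, mul_add, Finset.sum_add_distrib, Pi.single_apply, h1]
    rw [this, bitSign_add]
    simp [bitSign]
  simp only [Equiv.coe_addRight, h2, Finset.sum_neg_distrib] at h
  linarith

theorem isUnit_bitSign_innerProduct (n : ℕ) :
    IsUnit (Matrix.of fun x y => bitSign (innerProduct n x y)) := by
  set M := Matrix.of fun x y => bitSign (innerProduct n x y)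
  have hMM : M * ((2 : ℚ)^n)⁻¹ • M = 1 := by
    rw [Matrix.mul_smul]
    ext x x'
    have hadd : ∀ y, M x y * M y x' = bitSign (innerProduct n (x + x') y) := by
      intro y
      simp only [M, Matrix.of_apply]
      rw [← bitSign_add]
      congr 1
      simp only [innerProduct, ← Finset.sum_add_distrib, Pi.add_apply]
      exact Finset.sum_congr rfl fun i _ => by ring
    simp only [Matrix.smul_apply, Matrix.mul_apply, hadd, Matrix.one_apply]
    split_ifs with h
    · subst h
      have : x + x = 0 := funext fun i => CharTwo.add_self_eq_zero (x i)
      rw [this]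
      simp [innerProduct, bitSign]
    · rw [sum_bitSign_innerProduct, smul_zero]
      intro h'
      exact h (funext fun i => CharTwo.add_eq_zero.mp (congrFun h' i))
  exact IsUnit.of_mul_eq_one _ hMM

/-! ### The lower bound. -/

theorem Protocol.ComputesCleanly.lt_cost {n a b : ℕ} (hn : 1 ≤ n) {P : Protocol n a b}
    (hP : P.ComputesCleanly (innerProduct n)) : n + 1 ≤ P.cost := by
  obtain ⟨hleg, hrun, hA, -, hans⟩ := hP
  by_contra hlt
  have hle : P.cost ≤ n := by omega
  let T : (Fin n → ZMod 2) → (Fin n → ZMod 2) → List.Vector (ZMod 2) P.cost :=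
    fun x y => ⟨P.transcript (stdState a b x y 0), P.length_transcript _⟩
  have hpaste : ∀ x y x' y', T x y = T x' y' →
      T x y' = T x y ∧ innerProduct n x y' = innerProduct n x' y' := by
    intro x y x' y' h
    have := P.transcript_paste hleg (s₁ := stdState a b x y 0) (s₂ := stdState a b x' y' 0)
      (s₃ := stdState a b x y' 0)
      (by rintro (i | i | i | i | _) <;> simp [Reg.home, stdState])
      (by rintro (i | i | i | i | _) <;> simp [Reg.home, stdState]) (congrArg Subtype.val h)
    refine ⟨Subtype.ext this.1, ?_⟩
    have h2 := this.2.2 .ans hans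
    simpa [hrun, stdState] using h2
  have hcardV : Fintype.card (List.Vector (ZMod 2) P.cost) = 2 ^ P.cost := by simp
  have hcardX : Fintype.card (Fin n → ZMod 2) = 2 ^ n := by simp
  have hinj : Function.Injective fun x => T x 0 :=
    injective_of_rectangles _ (isUnit_bitSign_innerProduct n) (fun x y => bitSign_mul_self _) T
      (by rw [hcardV, hcardX]; exact Nat.pow_le_pow_right (by norm_num) hle)
      (fun x y x' y' h => (hpaste x y x' y' h).1)
      (fun x x' y h => congrArg bitSign (hpaste x y x' y h).2) 0
  have hsurj : Function.Surjective fun x => T x 0 := by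
    refine ((Fintype.bijective_iff_injective_and_card _).mpr ⟨hinj, ?_⟩).2
    refine le_antisymm (Fintype.card_le_of_injective _ hinj) ?_
    rw [hcardV, hcardX]
    exact Nat.pow_le_pow_right (by norm_num) hle
  have hbob := P.sent_eq_empty_of_surjective hleg
    (Set.range fun x => stdState a b x 0 0)
    (by
      rintro _ ⟨x, rfl⟩ _ ⟨x', rfl⟩ (i | i | i | i | _) <;> simp [Reg.home, stdState])
    (by
      intro l hl
      obtain ⟨x, hx⟩ := hsurj ⟨l, hl⟩
      exact ⟨_, ⟨x, rfl⟩, congrArg Subtype.val hx⟩)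
  have h01 : (0 : Fin n → ZMod 2) = 1 := hinj (Subtype.ext
    (P.transcript_eq_of_run_eq hleg hbob (s := stdState a b 0 0 0) (s' := stdState a b 1 0 0)
      (by
        rintro (i | i | i | i | _) hr
        · simp [hA] at hr
        all_goals simp [hrun, stdState, innerProduct])).1)
  exact zero_ne_one (congrFun h01 ⟨0, hn⟩)

end CleanComm

/-! ### Local operations for the upper bound, and their composition. -/

namespace CleanComm

/-- A vector supported on the first `k` positions. -/
def IsLow {n : ℕ} (k : ℕ) (v : Fin n → ZMod 2) : Prop := ∀ i : Fin n, k ≤ i → v i = 0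

/-- A map with values supported on the first `k` positions, which depends only on the other
positions of its argument. -/
structure IsHighToLow {n : ℕ} (k : ℕ) (p : (Fin n → ZMod 2) → Fin n → ZMod 2) : Prop where
  isLow : ∀ x, IsLow k (p x)
  add_eq : ∀ x e, IsLow k e → p (x + e) = p x

theorem IsLow.zero {n k : ℕ} : IsLow k (0 : Fin n → ZMod 2) := fun _ _ => rfl

theorem IsLow.add {n k : ℕ} {v w : Fin n → ZMod 2} (hv : IsLow k v) (hw : IsLow k w) :
    IsLow k (v + w) := fun i hi => by simp [hv i hi, hw i hi]

theorem IsLow.sum {n k : ℕ} {ι : Type*} {s : Finset ι} {v : ι → Fin n → ZMod 2}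
    (hv : ∀ j, IsLow k (v j)) : IsLow k (∑ j ∈ s, v j) := fun i hi => by
  simp [Finset.sum_apply, hv _ i hi]

theorem IsHighToLow.zero {n k : ℕ} : IsHighToLow (n := n) k fun _ => 0 :=
  ⟨fun _ => .zero, fun _ _ _ => rfl⟩

theorem IsHighToLow.sum {n k : ℕ} {ι : Type*} {s : Finset ι}
    {p : ι → (Fin n → ZMod 2) → Fin n → ZMod 2} (hp : ∀ j, IsHighToLow k (p j)) :
    IsHighToLow k fun x => ∑ j ∈ s, p j x :=
  ⟨fun x => .sum fun j => (hp j).isLow x,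
    fun x e he => Finset.sum_congr rfl fun j _ => (hp j).add_eq x e he⟩

theorem bits_add_self {n : ℕ} (v : Fin n → ZMod 2) : v + v = 0 :=
  funext fun i => CharTwo.add_self_eq_zero (v i)

theorem bits_add_add_cancel {n : ℕ} (v w : Fin n → ZMod 2) : v + w + w = v := by
  rw [add_assoc, bits_add_self, add_zero]

/-- Alice's input registers. -/
def State.fst {n a b : ℕ} (s : State n a b) : Fin n → ZMod 2 := fun i => s (.aliceIn i)

/-- Bob's input registers. -/
def State.snd {n a b : ℕ} (s : State n a b) : Fin n → ZMod 2 := fun i => s (.bobIn i)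

theorem State.ext_iff' {n : ℕ} {s s' : State n 0 0} :
    s = s' ↔ s.fst = s'.fst ∧ s.snd = s'.snd ∧ s .ans = s' .ans := by
  refine ⟨by rintro rfl; simp, fun ⟨h₁, h₂, h₃⟩ => funext ?_⟩
  rintro (i | i | i | i | _)
  · exact congrFun h₁ i
  · exact i.elim0
  · exact congrFun h₂ i
  · exact i.elim0
  · exact h₃

@[simp] theorem fst_stdState {n a b : ℕ} (x y : Fin n → ZMod 2) (z : ZMod 2) :
    State.fst (stdState a b x y z) = x := rfl

@[simp] theorem snd_stdState {n a b : ℕ} (x y : Fin n → ZMod 2) (z : ZMod 2) :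
    State.snd (stdState a b x y z) = y := rfl

@[simp] theorem stdState_ans {n a b : ℕ} (x y : Fin n → ZMod 2) (z : ZMod 2) :
    stdState a b x y z .ans = z := rfl

/-- Alice adds `p x` to her input `x`. -/
def aliceShift {n k : ℕ} {p : (Fin n → ZMod 2) → Fin n → ZMod 2} (hp : IsHighToLow k p) :
    Equiv.Perm (State n 0 0) :=
  Function.Involutive.toPerm (fun s => stdState 0 0 (s.fst + p s.fst) s.snd (s .ans)) fun s => by
    rw [State.ext_iff']
    simp [hp.add_eq _ _ (hp.isLow _), bits_add_add_cancel]

/-- Bob adds `q y` to Alice's input. -/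
def bobShift {n : ℕ} (q : (Fin n → ZMod 2) → Fin n → ZMod 2) : Equiv.Perm (State n 0 0) :=
  Function.Involutive.toPerm (fun s => stdState 0 0 (s.fst + q s.snd) s.snd (s .ans)) fun s => by
    rw [State.ext_iff']
    simp [bits_add_add_cancel]

/-- The value `G x y` is added to the answer register. -/
def ansShift {n : ℕ} (G : (Fin n → ZMod 2) → (Fin n → ZMod 2) → ZMod 2) :
    Equiv.Perm (State n 0 0) :=
  Function.Involutive.toPerm (fun s => stdState 0 0 s.fst s.snd (s .ans + G s.fst s.snd))
    fun s => by
    rw [State.ext_iff']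
    simp [add_assoc, CharTwo.add_self_eq_zero]

@[simp] theorem aliceShift_apply {n k : ℕ} {p : (Fin n → ZMod 2) → Fin n → ZMod 2}
    (hp : IsHighToLow k p) (s : State n 0 0) :
    aliceShift hp s = stdState 0 0 (s.fst + p s.fst) s.snd (s .ans) := rfl

@[simp] theorem bobShift_apply {n : ℕ} (q : (Fin n → ZMod 2) → Fin n → ZMod 2)
    (s : State n 0 0) :
    bobShift q s = stdState 0 0 (s.fst + q s.snd) s.snd (s .ans) := rfl

@[simp] theorem ansShift_apply {n : ℕ} (G : (Fin n → ZMod 2) → (Fin n → ZMod 2) → ZMod 2)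
    (s : State n 0 0) :
    ansShift G s = stdState 0 0 s.fst s.snd (s .ans + G s.fst s.snd) := rfl

/-- The first `k` input registers of Alice are held by `p`, the answer register by `q`, and all
other registers by their first holders. -/
def holder {n : ℕ} (k : ℕ) (p q : Player) : Reg n 0 0 → Player
  | .aliceIn i => if i < k then p else .alice
  | .aliceAnc _ => .alice
  | .bobIn _ => .bob
  | .bobAnc _ => .bob
  | .ans => q

/-- Some protocol of cost `c` leads from the holders `holder k p q` to `holder k p' q'`, and for
all `x`, `y`, `z` from the state `x + U x y`, `y`, `z` to `x + U' x y`, `y`, `z + E x y`. -/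
def Reaches {n : ℕ} (k : ℕ) (p q : Player) (U : (Fin n → ZMod 2) → (Fin n → ZMod 2) → Fin n → ZMod 2)
    (p' q' : Player) (U' : (Fin n → ZMod 2) → (Fin n → ZMod 2) → Fin n → ZMod 2)
    (E : (Fin n → ZMod 2) → (Fin n → ZMod 2) → ZMod 2) (c : ℕ) : Prop :=
  ∃ P : Protocol n 0 0, P.LegalFrom (holder k p q) ∧
    P.holderFrom (holder k p q) = holder k p' q' ∧
    (∀ x y z, P.run (stdState 0 0 (x + U x y) y z) =
      stdState 0 0 (x + U' x y) y (z + E x y)) ∧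
    P.cost = c

namespace Protocol

variable {n a b : ℕ} (P Q : Protocol n a b)

theorem legalFrom_append (h : Reg n a b → Player) :
    LegalFrom (P ++ Q) h ↔ P.LegalFrom h ∧ Q.LegalFrom (P.holderFrom h) := by
  induction P generalizing h with
  | nil => simp [LegalFrom, holderFrom]
  | cons t P ih => simp [LegalFrom, holderFrom, ih, and_assoc]

theorem holderFrom_append (h : Reg n a b → Player) :
    holderFrom (P ++ Q) h = Q.holderFrom (P.holderFrom h) := by
  induction P generalizing h with
  | nil => rfl
  | cons t P ih => simp [holderFrom, ih]

theorem run_append (s : State n a b) : run (P ++ Q) s = Q.run (P.run s) := by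
  induction P generalizing s with
  | nil => rfl
  | cons t P ih => simp [run, ih]

theorem cost_append : cost (P ++ Q) = P.cost + Q.cost := by
  induction P with
  | nil => simp [cost]
  | cons t P ih => simp [cost, ih, add_assoc]

end Protocol

namespace Reaches

variable {n k : ℕ} {p q p' q' p'' q'' : Player}
  {U U' U'' : (Fin n → ZMod 2) → (Fin n → ZMod 2) → Fin n → ZMod 2}
  {E E' : (Fin n → ZMod 2) → (Fin n → ZMod 2) → ZMod 2} {c c' : ℕ}

theorem trans (h : Reaches k p q U p' q' U' E c) (h' : Reaches k p' q' U' p'' q'' U'' E' c') :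
    Reaches k p q U p'' q'' U'' (E + E') (c + c') := by
  obtain ⟨P, h₁, h₂, h₃, h₄⟩ := h
  obtain ⟨Q, h₁', h₂', h₃', h₄'⟩ := h'
  refine ⟨P ++ Q, ?_, ?_, fun x y z => ?_, ?_⟩
  · rw [Protocol.legalFrom_append, h₂]; exact ⟨h₁, h₁'⟩
  · rw [Protocol.holderFrom_append, h₂, h₂']
  · rw [Protocol.run_append, h₃, h₃', Pi.add_apply, Pi.add_apply, add_assoc]
  · rw [Protocol.cost_append, h₄, h₄']

theorem of_act {op : Equiv.Perm (State n 0 0)} {r : Player}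
    (hact : ActsOn {i | holder k p q i = r} op)
    (hop : ∀ x y z, op (stdState 0 0 (x + U x y) y z) =
      stdState 0 0 (x + U' x y) y (z + E x y)) :
    Reaches k p q U p q U' E 0 :=
  ⟨[⟨r, op, ∅⟩], ⟨⟨hact, by simp⟩, trivial⟩,
    by funext i; simp [Protocol.holderFrom, Turn.newHolder], hop, rfl⟩

theorem of_send {sent : Finset (Reg n 0 0)} {r : Player}
    (hs : ∀ i ∈ sent, holder k p q i = r)
    (hh : ∀ i, holder k p' q' i = if i ∈ sent then r.other else holder k p q i) :
    Reaches k p q U p' q' U 0 sent.card :=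
  ⟨[⟨r, 1, sent⟩], ⟨⟨⟨fun _ _ _ => rfl, fun _ _ h => h⟩, hs⟩, trivial⟩,
    by funext i; simp [Protocol.holderFrom, Turn.newHolder, hh], by simp [Protocol.run], rfl⟩

/-- The shift is computed from the high positions, which `U` does not touch; Alice therefore applies
the intended `w x` although her low registers hold disturbed values. -/
theorem alice_shift (hU : ∀ x y, IsLow k (U x y)) {w : (Fin n → ZMod 2) → Fin n → ZMod 2}
    (hw : IsHighToLow k w) : Reaches k .alice q U .alice q (fun x y => U x y + w x) 0 0 := by
  refine of_act (op := aliceShift hw) (r := .alice) ⟨?_, ?_⟩ fun x y z => ?_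
  · rintro s (i | i | i | i | _) hr
    · simp [holder] at hr
    · exact i.elim0
    · rfl
    · exact i.elim0
    · rfl
  · intro s s' h
    have hf : s.fst = s'.fst := funext fun i => h (.aliceIn i) (by simp [holder])
    rintro (i | i | i | i | _) hr
    · simp [hf, stdState]
    · exact i.elim0
    · simp [holder] at hr
    · exact i.elim0
    · exact h _ hr
  · rw [State.ext_iff']
    simp [hw.add_eq _ _ (hU x y), add_assoc]

theorem bob_shift {v : (Fin n → ZMod 2) → Fin n → ZMod 2} (hv : ∀ y, IsLow k (v y)) :
    Reaches k .bob q U .bob q (fun x y => U x y + v y) 0 0 := by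
  refine of_act (op := bobShift v) (r := .bob) ⟨?_, ?_⟩ fun x y z => ?_
  · rintro s (i | i | i | i | _) hr
    · have hi : k ≤ i := by
        by_contra hi
        exact hr (by simp [holder, not_le.mp hi])
      simp [stdState, hv _ i hi, State.fst]
    · exact i.elim0
    · rfl
    · exact i.elim0
    · rfl
  · intro s s' h
    have hf : s.snd = s'.snd := funext fun i => h (.bobIn i) (by simp [holder])
    rintro (i | i | i | i | _) hr
    · have hi : s.fst i = s'.fst i := h _ hr
      simp [hf, hi, stdState]
    · exact i.elim0
    · exact h _ hr
    · exact i.elim0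
    · exact h _ hr
  · rw [State.ext_iff']
    simp [add_assoc]

theorem alice_ans (hU : ∀ x y, IsLow k (U x y)) {w : (Fin n → ZMod 2) → Fin n → ZMod 2}
    (hw : IsHighToLow k w) :
    Reaches k .alice .alice U .alice .alice U (fun x y => (x + U x y) ⬝ᵥ w x) 0 := by
  refine of_act (op := ansShift fun x _ => x ⬝ᵥ w x) (r := .alice) ⟨?_, ?_⟩ fun x y z => ?_
  · rintro s (i | i | i | i | _) hr
    · rfl
    · exact i.elim0
    · rfl
    · exact i.elim0
    · simp [holder] at hr
  · intro s s' h
    have hf : s.fst = s'.fst := funext fun i => h (.aliceIn i) (by simp [holder])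
    rintro (i | i | i | i | _) hr
    · exact h _ hr
    · exact i.elim0
    · simp [holder] at hr
    · exact i.elim0
    · simp [hf, h _ hr]
  · rw [State.ext_iff']
    simp [hw.add_eq _ _ (hU x y)]

theorem bob_ans {v : (Fin n → ZMod 2) → Fin n → ZMod 2} (hv : ∀ y, IsLow k (v y)) :
    Reaches k .bob .bob U .bob .bob U (fun x y => (x + U x y) ⬝ᵥ v y) 0 := by
  refine of_act (op := ansShift fun x y => x ⬝ᵥ v y) (r := .bob) ⟨?_, ?_⟩ fun x y z => ?_
  · rintro s (i | i | i | i | _) hr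
    · rfl
    · exact i.elim0
    · rfl
    · exact i.elim0
    · simp [holder] at hr
  · intro s s' h
    have hf : s.snd = s'.snd := funext fun i => h (.bobIn i) (by simp [holder])
    -- Bob holds only the first `k` of Alice's registers, and these suffice because `v` vanishes
    -- elsewhere.
    have hd : s.fst ⬝ᵥ v s'.snd = s'.fst ⬝ᵥ v s'.snd := by
      refine Finset.sum_congr rfl fun i _ => ?_
      by_cases hi : k ≤ i
      · simp [hv _ i hi]
      · have : s.fst i = s'.fst i := h (.aliceIn i) (by simp [holder, not_le.mp hi])
        rw [this]
    rintro (i | i | i | i | _) hr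
    · exact h _ hr
    · exact i.elim0
    · exact h _ hr
    · exact i.elim0
    · simp [hf, h _ hr, hd]
  · rw [State.ext_iff']
    simp

/-- The first `k` input registers of Alice. -/
def lowRegs (n k : ℕ) : Finset (Reg n 0 0) :=
  (Finset.univ.filter fun i : Fin n => (i : ℕ) < k).image .aliceIn

theorem card_lowRegs (hk : k ≤ n) : (lowRegs n k).card = k := by
  rw [lowRegs, Finset.card_image_of_injective _ fun i j h => by simpa using h]
  simp [Fin.card_filter_val_lt, hk]

theorem send_low (hk : k ≤ n) (p q : Player) : Reaches k p q U p.other q U 0 k := by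
  have := of_send (U := U) (p := p) (q := q) (p' := p.other) (q' := q) (sent := lowRegs n k)
    (k := k) (r := p) (by simp +contextual [lowRegs, holder]) (by
      rintro (i | i | i | i | _) <;> simp [lowRegs, holder]
      split_ifs <;> rfl)
  rwa [card_lowRegs hk] at this

theorem send_low_ans (hk : k ≤ n) (p : Player) :
    Reaches k p p U p.other p.other U 0 (k + 1) := by
  have := of_send (U := U) (p := p) (q := p) (p' := p.other) (q' := p.other)
    (sent := insert .ans (lowRegs n k)) (k := k) (r := p)
    (by simp +contextual [lowRegs, holder]) (by
      rintro (i | i | i | i | _) <;> simp [lowRegs, holder]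
      split_ifs <;> rfl)
  rwa [Finset.card_insert_of_notMem (by simp [lowRegs]), card_lowRegs hk] at this

theorem congr (h : Reaches k p q U p' q' U' E c) (hU : U' = U'') (hE : E = E') (hc : c = c') :
    Reaches k p q U p' q' U'' E' c' := by
  subst hU hE hc; exact h

/-- Bob sends his registers with `v y` added, Alice contributes the product with `w x` and replaces
`u x` by `u' x`, and Bob contributes the product with `v' y`. -/
theorem round (hk : k ≤ n) {u u' w v v' : (Fin n → ZMod 2) → Fin n → ZMod 2}
    (hu : IsHighToLow k u) (hu' : IsHighToLow k u') (hw : IsHighToLow k w)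
    (hv : ∀ y, IsLow k (v y)) (hv' : ∀ y, IsLow k (v' y)) :
    Reaches k .bob .bob (fun x _ => u x) .bob .bob (fun x _ => u' x)
      (fun x y => (x + v y) ⬝ᵥ w x + (x + u' x) ⬝ᵥ v' y) (2 * (k + 1)) := by
  have h₁ : Reaches k .bob .bob (fun x _ => u x) .alice .alice (fun _ y => v y) 0 (k + 1) :=
    ((bob_shift hv).trans ((send_low_ans hk .bob).trans (alice_shift
      (fun x y => (hu.isLow x).add (hv y)) hu))).congr
      (by funext x y; rw [add_comm (u x), bits_add_add_cancel]) (by simp) (by simp)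
  have h₂ : Reaches k .alice .alice (fun _ y => v y) .bob .bob (fun x _ => u' x)
      (fun x y => (x + v y) ⬝ᵥ w x) (k + 1) :=
    ((alice_ans (fun _ y => hv y) hw).trans ((alice_shift (fun _ y => hv y) hu').trans
      ((send_low_ans hk .alice).trans (bob_shift hv)))).congr
      (by funext x y; rw [add_comm (v y), bits_add_add_cancel]) (by simp) (by simp)
  exact (h₁.trans (h₂.trans (bob_ans hv'))).congr rfl (by funext x y; simp) (by ring)

end Reaches

/-! ### Blocks, and the protocol for the inner product. -/

/-- The `j`-th block of length `k`, moved to the first `k` positions. -/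
def block {n : ℕ} (k j : ℕ) (x : Fin n → ZMod 2) : Fin n → ZMod 2 := fun t =>
  if h : (t : ℕ) < k ∧ j * k + t < n then x ⟨j * k + t, h.2⟩ else 0

theorem isLow_block {n : ℕ} (k j : ℕ) (x : Fin n → ZMod 2) : IsLow k (block k j x) := by
  intro i hi
  rw [block, dif_neg]
  omega

theorem isHighToLow_block {n : ℕ} (k : ℕ) {j : ℕ} (hj : j ≠ 0) :
    IsHighToLow (n := n) k (block k j) := by
  refine ⟨isLow_block k j, fun x e he => funext fun t => ?_⟩
  have : k ≤ j * k + t := le_add_right (Nat.le_mul_of_pos_left k (Nat.pos_of_ne_zero hj))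
  simp only [block]
  split_ifs with h
  · simp [he ⟨j * k + t, h.2⟩ this]
  · rfl

theorem dotProduct_block_zero {n : ℕ} (k : ℕ) (x y : Fin n → ZMod 2) :
    x ⬝ᵥ block k 0 y = block k 0 x ⬝ᵥ block k 0 y := by
  refine Finset.sum_congr rfl fun t _ => ?_
  by_cases h : (t : ℕ) < k <;> simp [block, h]

theorem sum_range_mul_eq {M : Type*} [AddCommMonoid M] (g : ℕ → M) (m k : ℕ) :
    ∑ i ∈ Finset.range (m * k), g i =
      ∑ j ∈ Finset.range m, ∑ t ∈ Finset.range k, g (j * k + t) := by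
  induction m with
  | zero => simp
  | succ m ih => rw [Nat.succ_mul, Finset.sum_range_add, ih, Finset.sum_range_succ]

theorem sum_range_dotProduct_block {n k m : ℕ} (hk : k ≤ n) (hm : n ≤ m * k)
    (x y : Fin n → ZMod 2) :
    ∑ j ∈ Finset.range m, block k j x ⬝ᵥ block k j y = innerProduct n x y := by
  set g : ℕ → ZMod 2 := fun i => if h : i < n then x ⟨i, h⟩ * y ⟨i, h⟩ else 0 with hg
  have h₁ : innerProduct n x y = ∑ i ∈ Finset.range n, g i := by
    rw [Finset.sum_range]
    simp [innerProduct, hg]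
  have h₂ : ∀ j, block k j x ⬝ᵥ block k j y = ∑ t ∈ Finset.range k, g (j * k + t) := by
    intro j
    have h : ∑ t ∈ Finset.range k, g (j * k + t) =
        ∑ t ∈ Finset.range n, if t < k then g (j * k + t) else 0 := by
      rw [← Finset.sum_subset (Finset.range_mono hk) (by simp +contextual)]
      exact Finset.sum_congr rfl fun t ht => by rw [if_pos (by simpa using ht)]
    rw [h, Finset.sum_range]
    refine Finset.sum_congr rfl fun t _ => ?_
    by_cases h₁ : (t : ℕ) < k <;> by_cases h₂ : j * k + t < n <;> simp [block, hg, h₁, h₂]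
  rw [h₁, Finset.sum_congr rfl fun j _ => h₂ j, ← sum_range_mul_eq]
  refine (Finset.sum_subset (Finset.range_mono hm) fun i _ hi => ?_).symm
  simp only [Finset.mem_range] at hi
  simp [hg, hi]

/-- The first part of the protocol for the inner product, after which block `0` and the corrections
remain. -/
theorem reaches_blocks {n k : ℕ} (hk : k ≤ n) (l : ℕ) :
    Reaches (n := n) k .alice .bob 0 .bob .bob (fun x _ => block k (2 * l + 1) x)
      (fun x y =>
        ∑ i ∈ Finset.range (l + 1), (x + block k (2 * i + 1) x) ⬝ᵥ block k (2 * i + 1) y +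
        ∑ i ∈ Finset.range l, (x + block k (2 * i + 2) y) ⬝ᵥ block k (2 * i + 2) x)
      (k + l * (2 * (k + 1))) := by
  induction l with
  | zero =>
    refine ((Reaches.alice_shift (fun _ _ => .zero) (isHighToLow_block k one_ne_zero)).trans
      ((Reaches.send_low hk _ _).trans (Reaches.bob_ans (isLow_block k 1)))).congr ?_ ?_ ?_
    · funext x y; simp
    · funext x y; simp
    · simp
  | succ l ih =>
    refine (ih.trans (Reaches.round hk (isHighToLow_block k (by omega))
      (isHighToLow_block k (j := 2 * (l + 1) + 1) (by omega))
      (isHighToLow_block k (j := 2 * l + 2) (by omega)) (isLow_block k (2 * l + 2))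
      (isLow_block k (2 * (l + 1) + 1)))).congr rfl ?_ (by ring)
    funext x y
    simp only [Pi.add_apply, Finset.sum_range_succ]
    ring

theorem reaches_innerProduct {n k : ℕ} (hk : k ≤ n) (l : ℕ) (hl : n ≤ (2 * l + 2) * k) :
    Reaches (n := n) k .alice .bob 0 .alice .bob 0 (innerProduct n)
      (2 * k + (l + 1) * (2 * (k + 1))) := by
  -- The correcting round: Alice multiplies the clean carrier by the sum of her even blocks, Bob by
  -- the sum of his odd blocks plus his block `0`, which supplies the missing product.
  have hfin := Reaches.round hk (isHighToLow_block k (j := 2 * l + 1) (by omega)) IsHighToLow.zero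
    (IsHighToLow.sum (s := Finset.range l) fun i => isHighToLow_block k (j := 2 * i + 2) (by omega))
    (fun _ => IsLow.zero)
    (fun y => (isLow_block k 0 y).add
      (IsLow.sum (s := Finset.range (l + 1)) fun i => isLow_block k (2 * i + 1) y))
  refine ((reaches_blocks hk l).trans (hfin.trans (Reaches.send_low hk .bob .bob))).congr rfl ?_
    (by ring)
  funext x y
  have hsplit : innerProduct n x y = block k 0 x ⬝ᵥ block k 0 y +
      ∑ i ∈ Finset.range (l + 1), block k (2 * i + 1) x ⬝ᵥ block k (2 * i + 1) y +
      ∑ i ∈ Finset.range l, block k (2 * i + 2) x ⬝ᵥ block k (2 * i + 2) y := by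
    rw [← sum_range_dotProduct_block hk hl]
    clear hfin hl
    induction l with
    | zero => simp [Finset.sum_range_succ]
    | succ l ih =>
      rw [show 2 * (l + 1) + 2 = 2 * l + 2 + 1 + 1 by ring]
      simp only [Finset.sum_range_succ] at ih ⊢
      rw [show 2 * (l + 1) + 1 = 2 * l + 2 + 1 by ring]
      linear_combination ih
  rw [hsplit, ← dotProduct_block_zero]
  simp only [Pi.add_apply, add_zero, add_dotProduct, dotProduct_add,
    dotProduct_sum, Finset.sum_add_distrib]
  simp only [fun i => dotProduct_comm (block k (2 * i + 2) y) (block k (2 * i + 2) x)]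
  have h2 : (2 : ZMod 2) = 0 := rfl
  -- Each error term occurs twice, once from its block and once from the correction, and so vanishes
  -- modulo 2.
  linear_combination (∑ i ∈ Finset.range (l + 1), x ⬝ᵥ block k (2 * i + 1) y +
    ∑ i ∈ Finset.range l, x ⬝ᵥ block k (2 * i + 2) x) * h2

theorem exists_computesCleanly {n k : ℕ} (hk : k ≤ n) (l : ℕ) (hl : n ≤ (2 * l + 2) * k) :
    ∃ P : Protocol n 0 0, P.ComputesCleanly (innerProduct n) ∧
      P.cost = 2 * k + (l + 1) * (2 * (k + 1)) := by
  obtain ⟨P, h₁, h₂, h₃, h₄⟩ := reaches_innerProduct hk l hl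
  have hh : holder (n := n) k .alice .bob = Reg.home := by
    funext i
    cases i <;> simp [holder, Reg.home]
  rw [hh] at h₁ h₂
  exact ⟨P, ⟨h₁, by simpa using h₃, by simp [h₂, Reg.home], by simp [h₂, Reg.home],
    by simp [h₂, Reg.home]⟩, h₄⟩

/-- The cost of the protocol with about `√n` blocks. -/
theorem exists_computesCleanly_cost_le {n : ℕ} (hn : 1 ≤ n) :
    ∃ P : Protocol n 0 0, P.ComputesCleanly (innerProduct n) ∧
      (P.cost : ℝ) ≤ n + 4 * Real.sqrt n + 1 := by
  -- The number of blocks `m = 2 * l + 2` is the even one of `n.sqrt` and `n.sqrt + 1`, hence within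
  -- `1` of `√n`; `k` is `n / m` rounded up.
  obtain ⟨l, hl₁, hl₂⟩ : ∃ l : ℕ, n.sqrt ≤ 2 * l + 2 ∧ 2 * l + 2 ≤ n.sqrt + 1 :=
    ⟨(n.sqrt - 1) / 2, by have := Nat.sqrt_pos.mpr hn; omega,
      by have := Nat.sqrt_pos.mpr hn; omega⟩
  obtain ⟨m, hm⟩ : ∃ m, m = 2 * l + 2 := ⟨_, rfl⟩
  set k := (n + m - 1) / m with hk
  have hm0 : 0 < m := by omega
  have hkm : k * m ≤ n + m - 1 := Nat.div_mul_le_self _ _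
  have hkm' : n ≤ m * k := by
    have := Nat.lt_div_mul_add (a := n + m - 1) hm0
    rw [← hk, mul_comm] at this
    omega
  have hkn : k ≤ n := by
    have : n + m ≤ n * m + 1 := by nlinarith
    rw [hk]
    refine (Nat.div_le_div_right (by omega : n + m - 1 ≤ n * m)).trans ?_
    rw [Nat.mul_div_cancel _ hm0]
  obtain ⟨P, hP, hc⟩ := exists_computesCleanly hkn l (hm ▸ hkm')
  refine ⟨P, hP, ?_⟩
  have hc' : (P.cost : ℝ) = k * m + m + 2 * k := by
    rw [hc, hm]; push_cast; ring
  have hkr : (k : ℝ) * m ≤ n + m - 1 := by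
    have : k * m + 1 ≤ n + m := by omega
    have : ((k * m + 1 : ℕ) : ℝ) ≤ (n + m : ℕ) := by exact_mod_cast this
    push_cast at this
    linarith
  set r := Real.sqrt n
  have hr : r * r = n := Real.mul_self_sqrt (Nat.cast_nonneg n)
  have hr₁ : (n.sqrt : ℝ) ≤ r := Real.nat_sqrt_le_real_sqrt
  have hr₂ : r < n.sqrt + 1 := Real.real_sqrt_lt_nat_sqrt_succ
  have hm₁ : (n.sqrt : ℝ) ≤ m := by rw [hm]; exact_mod_cast hl₁
  have hm₂ : (m : ℝ) ≤ n.sqrt + 1 := by rw [hm]; exact_mod_cast hl₂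
  have hm0' : (0 : ℝ) < m := by exact_mod_cast hm0
  -- After multiplication by `m` and use of `k * m ≤ n + m - 1`, the cost bound reduces to exactly
  -- this inequality.
  have hsq : (r - m) ^ 2 ≤ 1 := by
    rw [sq_le_one_iff_abs_le_one, abs_le]
    constructor <;> linarith
  rw [hc']
  refine le_of_mul_le_mul_right ?_ hm0'
  nlinarith

end CleanComm

theorem theorem2 (n : ℕ) (hn : 1 ≤ n) :
    n + 1 ≤ CleanComm.cleanComplexity (CleanComm.innerProduct n) ∧
    (2 ≤ n →
      (CleanComm.cleanComplexity (CleanComm.innerProduct n) : ℝ)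
          ≤ n + 4 * Real.sqrt n + 1 / (Real.sqrt n - 1) + 2 ∧
      ∃ P : CleanComm.Protocol n 0 0,
        P.ComputesCleanly (CleanComm.innerProduct n) ∧
        (P.cost : ℝ) ≤ n + 4 * Real.sqrt n + 1 / (Real.sqrt n - 1) + 2) := by
  obtain ⟨P, hP, hc⟩ := CleanComm.exists_computesCleanly_cost_le hn
  refine ⟨le_csInf ⟨_, 0, 0, P, hP, rfl⟩ ?_, fun hn₂ => ?_⟩
  · rintro _ ⟨a, b, Q, hQ, rfl⟩
    exact hQ.lt_cost hn
  -- The protocol already achieves `n + 4√n + 1`, so only the sign of the fraction matters.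
  · have hpos : 0 < 1 / (Real.sqrt n - 1) := by
      have : (1 : ℝ) < Real.sqrt n := by
        rw [Real.lt_sqrt zero_le_one]
        exact_mod_cast (by omega : 1 ^ 2 < n)
      exact one_div_pos.mpr (by linarith)
    have hP' : (P.cost : ℝ) ≤ n + 4 * Real.sqrt n + 1 / (Real.sqrt n - 1) + 2 := by linarith
    refine ⟨?_, P, hP, hP'⟩
    have : CleanComm.cleanComplexity (CleanComm.innerProduct n) ≤ P.cost :=
      Nat.sInf_le ⟨0, 0, P, hP, rfl⟩
    exact le_trans (by exact_mod_cast this) hP'
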